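/- In the game of cops and robbers on a finite graph $G$, $k$ cops are first placed on vertices of $G$, and then the robber chooses a starting vertex. The two sides alternate turns, the cops moving first; in a turn, each cop (respectively the robber) moves to an adjacent vertex or stays put, and all positions are known to both sides. The cops win if at some point a cop is on the same vertex as the robber; the robber wins if he evades capture forever. The cop number $c(G)$ is the least $k$ such that $k$ cops can always win after finitely many turns, whatever the robber does. Let $\mathcal{Q}_n$ be the $n\times n$ queen graph, whose vertices are the squares of an $n\times n$ chessboard, two distinct squares being adjacent if they lie in a common row, column, diagonal or antidiagonal. **Theorem.** $c(\mathcal{Q}_n) = 3$ for all integers $n$ with $7 \le n \le 18$. -/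

import Mathlib

namespace CopsAndRobbers

/-- A strategy for `k` cops on the graph `G`. The cops see the whole history of the game; as their
own moves are determined by the strategy, the history is the list of the positions that the robber
has occupied so far, the most recent one first. `pos h i` is the vertex on which cop `i` stands
after the cops have answered the history `h`; in particular `pos []` is the initial placement, which
is chosen before the robber is placed. In each turn each cop stays or moves along an edge. -/
structure CopStrategy {V : Type*} (G : SimpleGraph V) (k : ℕ) where
  pos : List V → Fin k → V
  legal : ∀ (h : List V) (v : V) (i : Fin k),
    pos (v :: h) i = pos h i ∨ G.Adj (pos h i) (pos (v :: h) i)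

/-- A course of play of the robber: an arbitrary starting vertex `r 0`, and in each turn the robber
stays or moves along an edge. -/
def IsRobberPlay {V : Type*} (G : SimpleGraph V) (r : ℕ → V) : Prop :=
  ∀ t, r (t + 1) = r t ∨ G.Adj (r t) (r (t + 1))

/-- The robber's positions `r 0, …, r (t - 1)`, the most recent one first. -/
def history {V : Type*} (r : ℕ → V) : ℕ → List V
  | 0 => []
  | t + 1 => r t :: history r t

/-- The cops, following `σ`, capture the robber who plays `r`: at some time `t` a cop
is on the robber's vertex `r t`, either just after the robber has arrived there (the cops then being
at `σ.pos (history r t)`), or after the next move of the cops. -/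
def CopStrategy.Captures {V : Type*} {G : SimpleGraph V} {k : ℕ} (σ : CopStrategy G k)
    (r : ℕ → V) : Prop :=
  ∃ t i, σ.pos (history r t) i = r t ∨ σ.pos (history r (t + 1)) i = r t

/-- `G` is `k`-cop win: `k` cops have a strategy that captures the robber after finitely many turns,
however the robber plays. -/
def IsCopWin {V : Type*} (G : SimpleGraph V) (k : ℕ) : Prop :=
  ∃ σ : CopStrategy G k, ∀ r : ℕ → V, IsRobberPlay G r → σ.Captures r

/-- The cop number: the least `k` such that `G` is `k`-cop win. -/
noncomputable def copNumber {V : Type*} (G : SimpleGraph V) : ℕ :=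
  sInf {k : ℕ | IsCopWin G k}

/-- The `n × n` queen graph: two distinct squares are adjacent if they lie in a common row, column,
diagonal or antidiagonal. -/
def queenGraph (n : ℕ) : SimpleGraph (Fin n × Fin n) where
  Adj u v := u ≠ v ∧
    (u.1 = v.1 ∨ u.2 = v.2 ∨
      (u.1 : ℕ) + (v.2 : ℕ) = (v.1 : ℕ) + (u.2 : ℕ) ∨
      (u.1 : ℕ) + (u.2 : ℕ) = (v.1 : ℕ) + (v.2 : ℕ))
  symm := ⟨by
    rintro u v ⟨h, h'⟩
    refine ⟨h.symm, ?_⟩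
    rcases h' with h' | h' | h' | h'
    · exact Or.inl h'.symm
    · exact Or.inr (Or.inl h'.symm)
    · exact Or.inr (Or.inr (Or.inl h'.symm))
    · exact Or.inr (Or.inr (Or.inr h'.symm))⟩
  loopless := ⟨fun _ h => h.1 rfl⟩

end CopsAndRobbers

/-! Lower bound, for every n ≥ 7: the robber always has a move to a square that two cops do not
attack. A cop outside a row attacks at most three of its squares, so a row or column through the
robber that contains no cop has at least n - 6 safe squares. Otherwise one cop holds the robber's
row and the other his column, and a diagonal move works (`exists_safe_diagonal_offset`). Such a
robber is never caught (`not_isCopWin_of_escape`).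

Upper bound: for each n from 7 to 18 an explicit list of positions with the robber to move is a
winning strategy for three cops. After any robber move from a listed position he is attacked, or the
cops can reach a position strictly later in the list, up to board symmetry and the order of the
cops. Hence play ends within the length of the list (`robberLost_of_isDescending`). The condition is
a Boolean function evaluated by the kernel, which is why it is written with primitive operations on
natural numbers. -/

namespace CopsAndRobbers

/-! ### Capture by backward induction, and evasion, on an arbitrary graph. -/

section Game

variable {V : Type*} {G : SimpleGraph V} {k : ℕ}

/-- `v` can be reached from `u` in one turn. -/
def Near (G : SimpleGraph V) (u v : V) : Prop := v = u ∨ G.Adj u v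

/-- With the cops at `C` and the robber at `r`, the robber to move, the cops can force a capture
within `t` further turns. -/
def RobberLost (G : SimpleGraph V) {k : ℕ} : ℕ → (Fin k → V) → V → Prop
  | 0, _, _ => False
  | t + 1, C, r => ∀ r', Near G r r' → (∃ i, Near G (C i) r') ∨
      ∃ C' : Fin k → V, (∀ i, Near G (C i) (C' i)) ∧ RobberLost G t C' r'

/-- With the cops at `C` and the robber at `r`, the cops to move, the cops can capture the robber
at once or reach a position in which he is lost within `t` further turns. -/
def CopsReady (G : SimpleGraph V) (t : ℕ) (C : Fin k → V) (r : V) : Prop :=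
  (∃ i, Near G (C i) r) ∨ ∃ C' : Fin k → V, (∀ i, Near G (C i) (C' i)) ∧ RobberLost G t C' r

theorem RobberLost.succ {t : ℕ} {C : Fin k → V} {r : V} (h : RobberLost G t C r) :
    RobberLost G (t + 1) C r := by
  induction t generalizing C r with
  | zero => exact h.elim
  | succ t ih =>
    intro r' hr'
    rcases h r' hr' with h | ⟨C', hC, h⟩
    · exact Or.inl h
    · exact Or.inr ⟨C', hC, ih h⟩

theorem RobberLost.mono {s t : ℕ} (hst : s ≤ t) {C : Fin k → V} {r : V}
    (h : RobberLost G s C r) : RobberLost G t C r := by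
  induction hst with
  | refl => exact h
  | step _ ih => exact ih.succ

theorem near_map {V' : Type*} {G' : SimpleGraph V'} (φ : G ≃g G') {u v : V} (h : Near G u v) :
    Near G' (φ u) (φ v) :=
  h.imp (congrArg φ) φ.map_adj_iff.mpr

theorem RobberLost.map (φ : G ≃g G) {t : ℕ} {C : Fin k → V} {r : V} (h : RobberLost G t C r) :
    RobberLost G t (fun i => φ (C i)) (φ r) := by
  induction t generalizing C r with
  | zero => exact h.elim
  | succ t ih =>
    intro r' hr'
    have hr : Near G r (φ.symm r') := by simpa using near_map φ.symm hr'
    rcases h _ hr with ⟨i, h⟩ | ⟨C', hC, h⟩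
    · exact Or.inl ⟨i, by simpa using near_map φ h⟩
    · exact Or.inr ⟨_, fun i => near_map φ (hC i), by simpa using ih h⟩

/-- Which cop stands where does not matter. -/
theorem RobberLost.comp {m : ℕ} {f : Fin m → Fin k} (hf : f.Surjective) {t : ℕ} {C : Fin k → V}
    {r : V} (h : RobberLost G t C r) : RobberLost G t (C ∘ f) r := by
  induction t generalizing C r with
  | zero => exact h.elim
  | succ t ih =>
    intro r' hr'
    rcases h r' hr' with ⟨i, h⟩ | ⟨C', hC, h⟩
    · obtain ⟨j, rfl⟩ := hf i
      exact Or.inl ⟨j, h⟩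
    · exact Or.inr ⟨C' ∘ f, fun i => hC (f i), ih h⟩

theorem CopsReady.map (φ : G ≃g G) {t : ℕ} {C : Fin k → V} {r : V} (h : CopsReady G t C r) :
    CopsReady G t (fun i => φ (C i)) (φ r) := by
  rcases h with ⟨i, h⟩ | ⟨C', hC, h⟩
  · exact Or.inl ⟨i, near_map φ h⟩
  · exact Or.inr ⟨_, fun i => near_map φ (hC i), h.map φ⟩

theorem CopsReady.of_map (φ : G ≃g G) {t : ℕ} {C : Fin k → V} {r : V}
    (h : CopsReady G t (fun i => φ (C i)) (φ r)) : CopsReady G t C r := by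
  simpa using h.map φ.symm

/-- One move of the cops serves all bounds on the remaining number of turns. -/
theorem exists_response (G : SimpleGraph V) (C : Fin k → V) (v : V) :
    ∃ C' : Fin k → V, (∀ i, Near G (C i) (C' i)) ∧
      ∀ t, CopsReady G t C v → (∃ i, C' i = v) ∨ RobberLost G t C' v := by
  classical
  by_cases h : ∃ t, CopsReady G t C v
  -- The answer for the least feasible bound serves every larger one, by monotonicity.
  · rcases Nat.find_spec h with ⟨i, hi⟩ | ⟨C', hC, hl⟩
    · refine ⟨Function.update C i v, fun j => ?_, fun t _ => Or.inl ⟨i, by simp⟩⟩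
      by_cases hj : j = i
      · subst hj
        simpa using hi
      · exact Or.inl (by simp [hj])
    · exact ⟨C', hC, fun t ht => Or.inr (hl.mono (Nat.find_min' h ht))⟩
  · exact ⟨C, fun i => Or.inl rfl, fun t ht => (h ⟨t, ht⟩).elim⟩

/-- The strategy answers according to the current squares only. It need not know the bound, because
by `exists_response` the same answer lowers any valid bound; induction on the bound then gives
capture. -/
theorem isCopWin_of_copsReady (C : Fin k → V) (h : ∀ r, ∃ t, CopsReady G t C r) :
    IsCopWin G k := by
  choose next hnear hnext using exists_response (k := k) G
  let pos : List V → Fin k → V := fun l => l.rec C fun v _ c => next c v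
  refine ⟨⟨pos, fun l v i => hnear (pos l) v i⟩, fun r hr => ?_⟩
  have key : ∀ t T, CopsReady G t (pos (history r T)) (r T) →
      (CopStrategy.mk pos fun l v i => hnear (pos l) v i).Captures r := by
    intro t
    induction t with
    | zero =>
      intro T hT
      rcases hnext _ _ _ hT with ⟨i, hi⟩ | hl
      · exact ⟨T, i, Or.inr hi⟩
      · exact hl.elim
    | succ t ih =>
      intro T hT
      rcases hnext _ _ _ hT with ⟨i, hi⟩ | hl
      · exact ⟨T, i, Or.inr hi⟩
      · exact ih (T + 1) (hl _ (hr T))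
  obtain ⟨t, ht⟩ := h (r 0)
  exact key t 0 ht

/-- The robber evades `k` cops forever if he can start at, and from every vertex not occupied by a
cop can move to, a vertex that no cop can reach in one turn. -/
theorem not_isCopWin_of_escape
    (hstart : ∀ C : Fin k → V, ∃ r, ∀ i, ¬ Near G (C i) r)
    (hstep : ∀ (C : Fin k → V) (r : V), (∀ i, C i ≠ r) → ∃ r', Near G r r' ∧
      ∀ i, ¬ Near G (C i) r') : ¬ IsCopWin G k := by
  rintro ⟨σ, hσ⟩
  obtain ⟨r₀, hr₀⟩ := hstart (σ.pos [])
  choose! next hnear hsafe using hstep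
  -- The state is the robber's current vertex with the list of his earlier ones, so each move can
  -- take into account the cops' answer to the full history.
  let play : ℕ → V × List V := fun t =>
    t.rec (r₀, []) fun _ p => (next (σ.pos (p.1 :: p.2)) p.1, p.1 :: p.2)
  let r : ℕ → V := fun t => (play t).1
  have hist : ∀ t, (play t).2 = history r t := by
    intro t
    induction t with
    | zero => rfl
    | succ t ih => exact congrArg (r t :: ·) ih
  have hr : ∀ t, r (t + 1) = next (σ.pos (history r (t + 1))) (r t) := by
    intro t
    change next (σ.pos (r t :: (play t).2)) (r t) = _
    rw [hist]
    rfl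
  -- If no cop can reach the robber's vertex in one turn, none is on it after the cops' turn.
  have free : ∀ t, (∀ i, ¬ Near G (σ.pos (history r t) i) (r t)) →
      ∀ i, σ.pos (history r (t + 1)) i ≠ r t := by
    intro t h i hi
    refine h i ?_
    have := σ.legal (history r t) (r t) i
    rw [← hi]
    exact this
  have safe : ∀ t i, ¬ Near G (σ.pos (history r t) i) (r t) := by
    intro t
    induction t with
    | zero => exact hr₀
    | succ t ih =>
      rw [hr t]
      exact hsafe _ _ (free t ih)
  obtain ⟨t, i, h | h⟩ := hσ r fun t => by
    rw [hr t]
    exact hnear _ _ (free t (safe t))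
  · exact safe t i (Or.inl h.symm)
  · exact free t (safe t) i h

end Game

/-! ### The queen graph and its symmetries. -/

/-- Reachability in one queen move, in coordinates. -/
theorem near_queenGraph {n : ℕ} {u v : Fin n × Fin n} :
    Near (queenGraph n) u v ↔ (u.1 : ℕ) = v.1 ∨ (u.2 : ℕ) = v.2 ∨
      (u.1 : ℕ) + v.2 = v.1 + u.2 ∨ (u.1 : ℕ) + u.2 = v.1 + v.2 := by
  simp only [Near, queenGraph, Fin.ext_iff, Prod.ext_iff, ne_eq]
  omega

/-- The transposition of the board. -/
def transpose (n : ℕ) : queenGraph n ≃g queenGraph n where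
  toEquiv := Equiv.prodComm _ _
  map_rel_iff' := by
    simp only [queenGraph, Equiv.prodComm_apply, Prod.fst_swap, Prod.snd_swap, Fin.ext_iff,
      Prod.ext_iff, ne_eq]
    omega

/-- The reflection of the board that reverses the first coordinate. -/
def flip (n : ℕ) : queenGraph n ≃g queenGraph n where
  toEquiv := Equiv.prodCongr Fin.revPerm (Equiv.refl _)
  map_rel_iff' := by
    rintro ⟨a, b⟩ ⟨c, d⟩
    simp only [queenGraph, Equiv.prodCongr_apply, Prod.map, Fin.revPerm_apply, Equiv.refl_apply,
      Fin.ext_iff, Prod.ext_iff, ne_eq, Fin.val_rev]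
    omega

/-! ### Two cops do not suffice. -/

/-- A row without cops has a square that two cops do not attack. -/
theorem exists_safe_in_row {n : ℕ} (hn : 7 ≤ n) (a b : Fin n × Fin n) (x : Fin n)
    (ha : a.1 ≠ x) (hb : b.1 ≠ x) :
    ∃ y, ¬ Near (queenGraph n) a (x, y) ∧ ¬ Near (queenGraph n) b (x, y) := by
  -- For `e = 0, 1, -1` these are the columns where the column and the two diagonals of `u` meet row
  -- `x`; they may lie off the board, hence ℤ.
  let f (u : Fin n × Fin n) (e : ℤ) : ℤ := (u.2 : ℕ) + e * ((u.1 : ℕ) - (x : ℕ))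
  let s : Finset ℤ := {f a 0, f a 1, f a (-1), f b 0, f b 1, f b (-1)}
  have hs : s.card ≤ 6 := Finset.card_le_six
  have hlt : s.card < (Finset.univ.image fun y : Fin n => ((y : ℕ) : ℤ)).card := by
    rw [Finset.card_image_of_injective _ fun y z h => Fin.ext (by exact_mod_cast h)]
    simpa using by omega
  obtain ⟨_, hy, hys⟩ := Finset.exists_mem_notMem_of_card_lt_card hlt
  obtain ⟨y, -, rfl⟩ := Finset.mem_image.mp hy
  refine ⟨y, ?_⟩
  simp only [s, f, Finset.mem_insert, Finset.mem_singleton] at hys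
  simp only [near_queenGraph]
  rw [Fin.ne_iff_vne] at ha hb
  omega

theorem exists_safe_in_column {n : ℕ} (hn : 7 ≤ n) (a b : Fin n × Fin n) (y : Fin n)
    (ha : a.2 ≠ y) (hb : b.2 ≠ y) :
    ∃ x, ¬ Near (queenGraph n) a (x, y) ∧ ¬ Near (queenGraph n) b (x, y) := by
  obtain ⟨x, h₁, h₂⟩ := exists_safe_in_row hn a.swap b.swap y ha hb
  exact ⟨x, fun h => h₁ (near_map (transpose n) h), fun h => h₂ (near_map (transpose n) h)⟩

/-- With one cop on the robber's row and one on his column, the robber escapes diagonally: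
a square at the offset `(s, t)` with `|s| = |t|` is attacked by the cop on the row, at the offset
`d`, only if `t = d` or `2 * t = d`, and similarly for the other cop. -/
theorem exists_safe_diagonal_offset {n x y x' y' : ℤ} (hn : 7 ≤ n) (hx : 0 ≤ x) (hxn : x < n)
    (hy : 0 ≤ y) (hyn : y < n) (hx' : 0 ≤ x') (hxn' : x' < n) (hy' : 0 ≤ y') (hyn' : y' < n)
    (hxx : x' ≠ x) (hyy : y' ≠ y) :
    ∃ s t : ℤ, (s = t ∨ s = -t) ∧ t ≠ 0 ∧ 0 ≤ x + s ∧ x + s < n ∧ 0 ≤ y + t ∧ y + t < n ∧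
      x + s ≠ x' ∧ x + 2 * s ≠ x' ∧ y + t ≠ y' ∧ y + 2 * t ≠ y' := by
  -- None of 1, 3, 4 is twice another, so each cop rules out at most one of them. Against a single
  -- cop, 1 and 3 are enough; this gives `j` and `k`.
  obtain ⟨i, hi, hi', h₁, h₂, h₃, h₄⟩ : ∃ i : ℤ, 1 ≤ i ∧ i ≤ 4 ∧ |x' - x| ≠ i ∧ |x' - x| ≠ 2 * i ∧
      |y' - y| ≠ i ∧ |y' - y| ≠ 2 * i := by
    by_contra! H
    have := H 1
    have := H 3
    have := H 4
    omega
  obtain ⟨j, hj, hj', h₅, h₆⟩ : ∃ j : ℤ, 1 ≤ j ∧ j ≤ 3 ∧ |x' - x| ≠ j ∧ |x' - x| ≠ 2 * j := by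
    by_contra! H
    have := H 1
    have := H 3
    omega
  obtain ⟨k, hk, hk', h₇, h₈⟩ : ∃ k : ℤ, 1 ≤ k ∧ k ≤ 3 ∧ |y' - y| ≠ k ∧ |y' - y| ≠ 2 * k := by
    by_contra! H
    have := H 1
    have := H 3
    omega
  rcases lt_or_gt_of_ne hxx with hx₁ | hx₁ <;> rcases lt_or_gt_of_ne hyy with hy₁ | hy₁
  · rw [abs_of_neg (sub_neg.2 hx₁)] at h₁ h₂ h₅ h₆
    rw [abs_of_neg (sub_neg.2 hy₁)] at h₃ h₄ h₇ h₈
    -- One step away from both cops is safe. If the edge forbids it, the robber approaches only one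
    -- of them, by `j` or `k`. The other sign cases are reflections of this one.
    by_cases hA : x + 1 < n ∧ y + 1 < n
    · exact ⟨1, 1, by omega⟩
    by_cases hB : 3 ≤ x ∧ y + 3 < n
    · exact ⟨-j, j, by omega⟩
    by_cases hC : x + 3 < n ∧ 3 ≤ y
    · exact ⟨k, -k, by omega⟩
    -- Here both coordinates are at least `n - 3 ≥ 4`, which leaves room for `i ≤ 4`.
    · exact ⟨-i, -i, by omega⟩
  · rw [abs_of_neg (sub_neg.2 hx₁)] at h₁ h₂ h₅ h₆
    rw [abs_of_pos (sub_pos.2 hy₁)] at h₃ h₄ h₇ h₈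
    by_cases hA : x + 1 < n ∧ 1 ≤ y
    · exact ⟨1, -1, by omega⟩
    by_cases hB : 3 ≤ x ∧ 3 ≤ y
    · exact ⟨-j, -j, by omega⟩
    by_cases hC : x + 3 < n ∧ y + 3 < n
    · exact ⟨k, k, by omega⟩
    · exact ⟨-i, i, by omega⟩
  · rw [abs_of_pos (sub_pos.2 hx₁)] at h₁ h₂ h₅ h₆
    rw [abs_of_neg (sub_neg.2 hy₁)] at h₃ h₄ h₇ h₈
    by_cases hA : 1 ≤ x ∧ y + 1 < n
    · exact ⟨-1, 1, by omega⟩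
    by_cases hB : x + 3 < n ∧ y + 3 < n
    · exact ⟨j, j, by omega⟩
    by_cases hC : 3 ≤ x ∧ 3 ≤ y
    · exact ⟨-k, -k, by omega⟩
    · exact ⟨i, -i, by omega⟩
  · rw [abs_of_pos (sub_pos.2 hx₁)] at h₁ h₂ h₅ h₆
    rw [abs_of_pos (sub_pos.2 hy₁)] at h₃ h₄ h₇ h₈
    by_cases hA : 1 ≤ x ∧ 1 ≤ y
    · exact ⟨-1, -1, by omega⟩
    by_cases hB : x + 3 < n ∧ 3 ≤ y
    · exact ⟨j, -j, by omega⟩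
    by_cases hC : 3 ≤ x ∧ y + 3 < n
    · exact ⟨-k, k, by omega⟩
    · exact ⟨i, i, by omega⟩

/-- From a vertex not occupied by one of two cops, the robber can move to a square that they do not
attack. -/
theorem exists_safe_move {n : ℕ} (hn : 7 ≤ n) (a b r : Fin n × Fin n) (ha : a ≠ r) (hb : b ≠ r) :
    ∃ r', Near (queenGraph n) r r' ∧ ¬ Near (queenGraph n) a r' ∧ ¬ Near (queenGraph n) b r' := by
  have diag : ∀ a b : Fin n × Fin n, a.1 = r.1 → b.2 = r.2 → a ≠ r → b ≠ r →
      ∃ r', Near (queenGraph n) r r' ∧ ¬ Near (queenGraph n) a r' ∧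
        ¬ Near (queenGraph n) b r' := by
    rintro ⟨_, y'⟩ ⟨x', _⟩ rfl rfl ha hb
    obtain ⟨x, y⟩ := r
    have hy : y'.1 ≠ y.1 := fun h => ha (Prod.ext rfl (Fin.ext h))
    have hx : x'.1 ≠ x.1 := fun h => hb (Prod.ext (Fin.ext h) rfl)
    obtain ⟨s, t, h⟩ := exists_safe_diagonal_offset (n := n) (x := x.1) (y := y.1) (x' := x'.1)
      (y' := y'.1) (by omega) (by omega) (by omega) (by omega) (by omega) (by omega) (by omega)
      (by omega) (by omega) (by omega) (by omega)
    refine ⟨(⟨(x.1 + s).toNat, by omega⟩, ⟨(y.1 + t).toNat, by omega⟩), ?_⟩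
    simp only [near_queenGraph]
    omega
  by_cases hrow : a.1 ≠ r.1 ∧ b.1 ≠ r.1
  · obtain ⟨y, hy⟩ := exists_safe_in_row hn a b r.1 hrow.1 hrow.2
    exact ⟨(r.1, y), near_queenGraph.mpr (Or.inl rfl), hy⟩
  by_cases hcol : a.2 ≠ r.2 ∧ b.2 ≠ r.2
  · obtain ⟨x, hx⟩ := exists_safe_in_column hn a b r.2 hcol.1 hcol.2
    exact ⟨(x, r.2), near_queenGraph.mpr (Or.inr (Or.inl rfl)), hx⟩
  -- A cop on both the row and the column of `r` would stand on `r`; so one cop holds the row and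
  -- the other the column.
  by_cases h₁ : a.1 = r.1
  · have h₂ : b.2 = r.2 := by
      by_contra h₂
      exact hcol ⟨fun h => ha (Prod.ext h₁ h), h₂⟩
    exact diag a b h₁ h₂ ha hb
  · have h₂ : b.1 = r.1 := by
      by_contra h₂
      exact hrow ⟨h₁, h₂⟩
    have h₃ : a.2 = r.2 := by
      by_contra h₃
      exact hcol ⟨h₃, fun h => hb (Prod.ext h₂ h)⟩
    obtain ⟨r', h, h', h''⟩ := diag b a h₂ h₃ hb ha
    exact ⟨r', h, h'', h'⟩

theorem exists_safe_start {n : ℕ} (hn : 7 ≤ n) (a b : Fin n × Fin n) :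
    ∃ r, ¬ Near (queenGraph n) a r ∧ ¬ Near (queenGraph n) b r := by
  obtain ⟨x, hx⟩ : ∃ x : Fin n, x ∉ ({a.1, b.1} : Finset (Fin n)) := by
    by_contra! H
    have h := Finset.card_le_card fun x (_ : x ∈ Finset.univ) => H x
    have : ({a.1, b.1} : Finset (Fin n)).card ≤ 2 := Finset.card_le_two
    rw [Finset.card_univ, Fintype.card_fin] at h
    omega
  simp only [Finset.mem_insert, Finset.mem_singleton, not_or] at hx
  obtain ⟨y, hy⟩ := exists_safe_in_row hn a b x (Ne.symm hx.1) (Ne.symm hx.2)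
  exact ⟨_, hy⟩

theorem not_isCopWin_queenGraph {n k : ℕ} (hn : 7 ≤ n) (hk : k < 3) :
    ¬ IsCopWin (queenGraph n) k := by
  let v : Fin n × Fin n := (⟨0, by omega⟩, ⟨0, by omega⟩)
  interval_cases k
  · exact not_isCopWin_of_escape (fun _ => ⟨v, fun i => i.elim0⟩)
      fun _ r _ => ⟨r, Or.inl rfl, fun i => i.elim0⟩
  -- A single cop is treated as two cops on the same square.
  · refine not_isCopWin_of_escape (fun C => ?_) fun C r hC => ?_
    · obtain ⟨r, h, -⟩ := exists_safe_start hn (C 0) (C 0)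
      exact ⟨r, by simpa using h⟩
    · obtain ⟨r', h, h', -⟩ := exists_safe_move hn (C 0) (C 0) r (hC 0) (hC 0)
      exact ⟨r', h, by simpa using h'⟩
  · refine not_isCopWin_of_escape (fun C => ?_) fun C r hC => ?_
    · obtain ⟨r, h⟩ := exists_safe_start hn (C 0) (C 1)
      exact ⟨r, by simpa [Fin.forall_fin_two] using h⟩
    · obtain ⟨r', h, h'⟩ := exists_safe_move hn (C 0) (C 1) r (hC 0) (hC 1)
      exact ⟨r', h, by simpa [Fin.forall_fin_two] using h'⟩

/-! ### A checker for strategies of three cops, and its soundness. -/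

section Certificate

variable {n : ℕ}

/-- Decides `Near (queenGraph n)`. -/
def near (u v : Fin n × Fin n) : Bool :=
  Nat.beq u.1 v.1 || (Nat.beq u.2 v.2 || (Nat.beq (Nat.add u.1 v.2) (Nat.add v.1 u.2) ||
    Nat.beq (Nat.add u.1 u.2) (Nat.add v.1 v.2)))

theorem near_iff {u v : Fin n × Fin n} : near u v = true ↔ Near (queenGraph n) u v := by
  simp [near, near_queenGraph, Nat.beq_eq]

/-- The eight symmetries of the board. -/
def image (s f g : Bool) (u : Fin n × Fin n) : Fin n × Fin n :=
  (cond f (cond s u.2 u.1).rev (cond s u.2 u.1), cond g (cond s u.1 u.2).rev (cond s u.1 u.2))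

theorem exists_iso_eq_image (s f g : Bool) :
    ∃ φ : queenGraph n ≃g queenGraph n, ∀ u, φ u = image s f g u := by
  let τ := transpose n
  let ρ := flip n
  -- Conjugation by the transposition gives the reversal of the second coordinate.
  let σ := (τ.trans ρ).trans τ
  let e := SimpleGraph.Iso.refl (G := queenGraph n)
  exact ⟨((cond s τ e).trans (cond f ρ e)).trans (cond g σ e), fun u => by
    cases s <;> cases f <;> cases g <;> rfl⟩

/-- The square with the code `100 * x + y` is the one with the coordinates `x` and `y`. -/
def square (n : ℕ) [NeZero n] (c : ℕ) : Fin n × Fin n :=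
  (Fin.ofNat n (Nat.div c 100), Fin.ofNat n (Nat.mod c 100))

/-- The bound on `n` keeps the second coordinate within two decimal digits. -/
theorem square_code [NeZero n] (hn : n ≤ 100) (u : Fin n × Fin n) :
    square n (Nat.add (Nat.mul 100 u.1) u.2) = u := by
  obtain ⟨⟨x, hx⟩, ⟨y, hy⟩⟩ := u
  refine Prod.ext (Fin.ext ?_) (Fin.ext ?_)
  · change (100 * x + y) / 100 % n = x
    rw [show (100 * x + y) / 100 = x by omega, Nat.mod_eq_of_lt hx]
  · change (100 * x + y) % 100 % n = y
    rw [show (100 * x + y) % 100 = y by omega, Nat.mod_eq_of_lt hy]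

/-- A position of the game with three cops: the codes of the square of the robber and of the squares
of the cops. -/
abbrev Position := ℕ × ℕ × ℕ × ℕ

/-- The robber's square. -/
def Position.robber (n : ℕ) [NeZero n] (p : Position) : Fin n × Fin n := square n p.1

/-- The cops' squares. -/
def Position.cops (n : ℕ) [NeZero n] (p : Position) : Fin 3 → Fin n × Fin n :=
  ![square n p.2.1, square n p.2.2.1, square n p.2.2.2]

/-- Cops at `a`, `b`, `c` can move to `a'`, `b'`, `c'` in some order. -/
def canMove (a b c a' b' c' : Fin n × Fin n) : Bool :=
  (near a a' && ((near b b' && near c c') || (near b c' && near c b'))) ||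
  ((near a b' && ((near b a' && near c c') || (near b c' && near c a'))) ||
  (near a c' && ((near b a' && near c b') || (near b b' && near c a'))))

theorem exists_surjective_of_canMove {a b c a' b' c' : Fin n × Fin n}
    (h : canMove a b c a' b' c' = true) :
    ∃ f : Fin 3 → Fin 3, f.Surjective ∧
      ∀ i, Near (queenGraph n) (![a, b, c] i) ((![a', b', c'] ∘ f) i) := by
  simp only [canMove, Bool.or_eq_true, Bool.and_eq_true, near_iff] at h
  rcases h with ⟨h₁, ⟨h₂, h₃⟩ | ⟨h₂, h₃⟩⟩ | ⟨h₁, ⟨h₂, h₃⟩ | ⟨h₂, h₃⟩⟩ | ⟨h₁, ⟨h₂, h₃⟩ | ⟨h₂, h₃⟩⟩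
  · exact ⟨![0, 1, 2], by decide, Fin.forall_fin_succ.2 ⟨h₁, Fin.forall_fin_two.2 ⟨h₂, h₃⟩⟩⟩
  · exact ⟨![0, 2, 1], by decide, Fin.forall_fin_succ.2 ⟨h₁, Fin.forall_fin_two.2 ⟨h₂, h₃⟩⟩⟩
  · exact ⟨![1, 0, 2], by decide, Fin.forall_fin_succ.2 ⟨h₁, Fin.forall_fin_two.2 ⟨h₂, h₃⟩⟩⟩
  · exact ⟨![1, 2, 0], by decide, Fin.forall_fin_succ.2 ⟨h₁, Fin.forall_fin_two.2 ⟨h₂, h₃⟩⟩⟩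
  · exact ⟨![2, 0, 1], by decide, Fin.forall_fin_succ.2 ⟨h₁, Fin.forall_fin_two.2 ⟨h₂, h₃⟩⟩⟩
  · exact ⟨![2, 1, 0], by decide, Fin.forall_fin_succ.2 ⟨h₁, Fin.forall_fin_two.2 ⟨h₂, h₃⟩⟩⟩

/-- Cops at `a`, `b`, `c` can move to one of the positions of `l`, with the robber at `r`. -/
def canReach [NeZero n] (a b c r : Fin n × Fin n) (l : List Position) : Bool :=
  l.any fun p => Nat.beq p.1 (Nat.add (Nat.mul 100 r.1) r.2) &&
    canMove a b c (square n p.2.1) (square n p.2.2.1) (square n p.2.2.2)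

/-- The robber at `r` is attacked by one of the cops at `a`, `b`, `c`, or the cops can move to a
position that is an image of one in `l` under a symmetry of the board. The robber's square in the
image is sought in one octant of the board only. -/
def answers [NeZero n] (a b c r : Fin n × Fin n) (l : List Position) : Bool :=
  near a r || (near b r || (near c r ||
    [false, true].any fun s => [false, true].any fun f => [false, true].any fun g =>
      (Nat.ble (image s f g r).1 (image s f g r).2 &&
        Nat.blt (Nat.add (image s f g r).1 (image s f g r).2) n) &&
      canReach (image s f g a) (image s f g b) (image s f g c) (image s f g r) l))

/-- `p` holds for all squares. -/
def allSquares (n : ℕ) [NeZero n] (p : Fin n × Fin n → Bool) : Bool :=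
  (List.range n).all fun x => (List.range n).all fun y => p (Fin.ofNat n x, Fin.ofNat n y)

/-- `p` holds for all squares within one queen move of `u`. -/
def allMoves [NeZero n] (u : Fin n × Fin n) (p : Fin n × Fin n → Bool) : Bool :=
  (List.range n).all fun k => p (u.1, Fin.ofNat n k) && (p (Fin.ofNat n k, u.2) &&
    ((!(Nat.ble u.1 (Nat.add k u.2) && Nat.blt (Nat.sub (Nat.add k u.2) u.1) n) ||
        p (Fin.ofNat n k, Fin.ofNat n (Nat.sub (Nat.add k u.2) u.1))) &&
      (!(Nat.ble k (Nat.add u.1 u.2) && Nat.blt (Nat.sub (Nat.add u.1 u.2) k) n) ||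
        p (Fin.ofNat n k, Fin.ofNat n (Nat.sub (Nat.add u.1 u.2) k)))))

/-- In each position of the list, whatever the robber does, the cops can capture him or move to a
later position of the list, up to symmetry. -/
def isDescending (n : ℕ) [NeZero n] : List Position → Bool
  | [] => true
  | p :: l => (allMoves (square n p.1) fun r =>
      answers (square n p.2.1) (square n p.2.2.1) (square n p.2.2.2) r l) && isDescending n l

/-- The cops win from the squares `a`, `b`, `c` by moving through positions of `l`. -/
def isWinning (n : ℕ) [NeZero n] (a b c : ℕ) (l : List Position) : Bool :=
  (allSquares n fun r => answers (square n a) (square n b) (square n c) r l) && isDescending n l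

theorem of_allSquares [NeZero n] {p : Fin n × Fin n → Bool} (h : allSquares n p = true)
    (u : Fin n × Fin n) : p u = true := by
  simp only [allSquares, List.all_eq_true, List.mem_range] at h
  simpa using h u.1 u.1.2 u.2 u.2.2

theorem of_allMoves [NeZero n] {u v : Fin n × Fin n} {p : Fin n × Fin n → Bool}
    (h : allMoves u p = true) (hv : Near (queenGraph n) u v) : p v = true := by
  obtain ⟨x, y⟩ := v
  simp only [allMoves, List.all_eq_true, List.mem_range, Bool.and_eq_true] at h
  have hx := h x x.2
  simp only [Fin.ofNat_val_eq_self] at hx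
  rcases near_queenGraph.mp hv with hv | hv | hv | hv
  · have := (h y y.2).1
    rwa [Fin.ofNat_val_eq_self, Fin.ext hv] at this
  · have := hx.2.1
    rwa [Fin.ext hv] at this
  -- On the diagonals the guards of `allMoves` must be shown to hold; they exclude truncated
  -- subtraction and wrapping modulo `n`.
  · have hle : (u.1 : ℕ) ≤ Nat.add x u.2 := by simp only [Nat.add_eq] at hv ⊢; omega
    have hy : Nat.sub (Nat.add x u.2) u.1 = y :=
      Nat.sub_eq_of_eq_add (by simp only [Nat.add_eq] at hv ⊢; omega)
    have := hx.2.2.1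
    rw [hy, Nat.ble_eq.mpr hle, Nat.blt_eq.mpr y.2, Fin.ofNat_val_eq_self] at this
    exact this
  · have hle : (x : ℕ) ≤ Nat.add u.1 u.2 := by simp only [Nat.add_eq] at hv ⊢; omega
    have hy : Nat.sub (Nat.add u.1 u.2) x = y :=
      Nat.sub_eq_of_eq_add (by simp only [Nat.add_eq] at hv ⊢; omega)
    have := hx.2.2.2
    rw [hy, Nat.ble_eq.mpr hle, Nat.blt_eq.mpr y.2, Fin.ofNat_val_eq_self] at this
    exact this

theorem copsReady_of_answers [NeZero n] (hn : n ≤ 100) {l : List Position} {t : ℕ}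
    (hl : ∀ p ∈ l, RobberLost (queenGraph n) t (p.cops n) (p.robber n))
    {a b c r : Fin n × Fin n} (h : answers a b c r l = true) :
    CopsReady (queenGraph n) t ![a, b, c] r := by
  simp only [answers, Bool.or_eq_true, List.any_eq_true, near_iff] at h
  rcases h with h | h | h | ⟨s, -, f, -, g, -, h⟩
  · exact Or.inl ⟨0, h⟩
  · exact Or.inl ⟨1, h⟩
  · exact Or.inl ⟨2, h⟩
  · rw [Bool.and_eq_true] at h
    -- The octant test, discarded here, only shortens the search and plays no role in soundness.
    obtain ⟨p, hp, h⟩ := List.any_eq_true.mp h.2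
    obtain ⟨hr, hC⟩ := (Bool.and_eq_true _ _).mp h
    obtain ⟨e, he, hnear⟩ := exists_surjective_of_canMove hC
    obtain ⟨φ, hφ⟩ := exists_iso_eq_image (n := n) s f g
    have hlost := (hl p hp).comp he
    rw [Position.robber, Nat.beq_eq.mp hr, square_code hn] at hlost
    refine CopsReady.of_map φ (Or.inr ⟨_, fun i => ?_, by rw [hφ]; exact hlost⟩)
    convert hnear i using 1
    · exact (hφ _).trans (by fin_cases i <;> rfl)
    · rfl

/-- Induction from the end of the list: every answer from the head leads into the tail, so the head
needs one turn more than the tail. -/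
theorem robberLost_of_isDescending [NeZero n] (hn : n ≤ 100) {l : List Position}
    (h : isDescending n l = true) :
    ∀ p ∈ l, RobberLost (queenGraph n) l.length (p.cops n) (p.robber n) := by
  induction l with
  | nil => simp
  | cons q l ih =>
    obtain ⟨hq, hl⟩ := (Bool.and_eq_true _ _).mp h
    rintro p hp
    rcases List.mem_cons.mp hp with rfl | hp
    · exact fun r hr => copsReady_of_answers hn (ih hl) (of_allMoves hq hr)
    · exact (ih hl p hp).succ

theorem isCopWin_of_isWinning [NeZero n] (hn : n ≤ 100) {a b c : ℕ} {l : List Position}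
    (h : isWinning n a b c l = true) : IsCopWin (queenGraph n) 3 := by
  obtain ⟨h₁, h₂⟩ := (Bool.and_eq_true _ _).mp h
  exact isCopWin_of_copsReady ![square n a, square n b, square n c] fun r =>
    ⟨_, copsReady_of_answers hn (robberLost_of_isDescending hn h₂) (of_allSquares h₁ r)⟩

end Certificate

/-! Winning strategies of three cops on the boards of side 7 to 18. -/

/-- The cops start at (0,0), (2,5), (4,2); the entry `(3, 302, 303, 304)` has the robber at (0,3)
and the cops at (3,2), (3,3), (3,4). In the last position of such a list, every move of the robber,
staying included, ends on an attacked square. -/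
theorem isWinning_7 : isWinning 7 0 205 402
    [(3, 302, 303, 304), (5, 302, 303, 304), (103, 2, 100, 303), (104, 302, 303, 304)] = true := by
  decide +kernel

theorem isWinning_8 : isWinning 8 7 100 503
    [(2, 0, 204, 302), (4, 0, 204, 302), (101, 1, 100, 202), (103, 107, 202, 403),
    (203, 3, 207, 502), (204, 202, 404, 501), (205, 5, 207, 502)] = true := by
  decide +kernel

theorem isWinning_9 : isWinning 9 207 404 502
    [(1, 0, 304, 801), (2, 0, 103, 502), (2, 1, 402, 406), (3, 0, 108, 403), (5, 0, 205, 301),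
    (102, 1, 104, 302), (103, 2, 101, 403), (103, 101, 204, 403), (105, 5, 107, 402),
    (105, 106, 305, 400), (205, 203, 405, 502)] = true := by
  decide +kernel

theorem isWinning_10 : isWinning 10 303 405 504
    [(1, 0, 304, 401), (2, 0, 305, 702), (3, 0, 104, 403), (102, 104, 203, 502),
    (106, 105, 306, 403), (107, 105, 307, 503), (206, 204, 406, 503)] = true := by
  decide +kernel

theorem isWinning_11 : isWinning 11 405 506 604
    [(103, 108, 204, 503), (0, 4, 100, 505), (1, 10, 201, 304), (2, 1, 305, 402), (3, 1, 104, 603),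
    (3, 2, 306, 403), (4, 1, 105, 404), (8, 10, 308, 404), (101, 103, 201, 404),
    (102, 103, 302, 304), (103, 100, 204, 503), (107, 106, 307, 404), (207, 205, 407, 504),
    (208, 206, 408, 604), (307, 305, 507, 604)] = true := by
  decide +kernel

theorem isWinning_12 : isWinning 12 404 507 605
    [(106, 406, 504, 605), (305, 505, 606, 704), (4, 0, 307, 704), (6, 4, 503, 606),
    (103, 101, 507, 703), (104, 106, 407, 504), (204, 206, 507, 604), (205, 304, 306, 505),
    (208, 204, 408, 505), (307, 305, 507, 604), (2, 0, 406, 502), (2, 11, 103, 402),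
    (3, 0, 103, 205), (3, 1, 205, 303), (4, 2, 307, 404), (4, 2, 408, 604), (8, 10, 308, 404),
    (8, 10, 608, 701), (9, 0, 209, 504), (9, 4, 209, 405), (10, 6, 110, 505), (10, 8, 210, 505),
    (101, 103, 201, 404), (102, 106, 203, 502), (104, 100, 205, 704), (108, 106, 308, 405),
    (108, 107, 308, 405), (109, 107, 309, 505), (109, 108, 309, 703), (202, 203, 302, 404),
    (208, 206, 408, 505), (308, 108, 310, 605)] = true := by
  decide +kernel

theorem isWinning_13 : isWinning 13 506 607 705
    [(4, 5, 307, 504), (308, 306, 508, 605), (5, 3, 510, 605), (103, 105, 203, 406),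
    (104, 112, 205, 504), (204, 206, 507, 604), (210, 10, 211, 705), (408, 406, 608, 705),
    (0, 6, 500, 505), (1, 5, 201, 506), (2, 0, 406, 602), (3, 1, 306, 503), (3, 2, 306, 403),
    (4, 0, 105, 604), (4, 2, 307, 804), (9, 12, 209, 603), (10, 11, 410, 505),
    (101, 103, 201, 505), (102, 103, 302, 405), (103, 2, 100, 303), (103, 105, 303, 406),
    (104, 100, 205, 704), (104, 101, 205, 504), (203, 205, 403, 506), (303, 305, 503, 606)]
    = true := by
  decide +kernel

theorem isWinning_14 : isWinning 14 506 608 705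
    [(105, 100, 408, 505), (304, 307, 405, 604), (306, 305, 609, 706), (6, 105, 410, 706),
    (105, 107, 509, 705), (106, 5, 7, 406), (204, 406, 504, 1005), (206, 105, 107, 506),
    (206, 200, 307, 606), (208, 6, 308, 505), (507, 505, 707, 804), (6, 105, 107, 506),
    (6, 106, 208, 303), (6, 106, 208, 402), (103, 105, 503, 507), (106, 205, 207, 506),
    (108, 107, 508, 603), (202, 207, 505, 602), (204, 206, 608, 804), (205, 106, 505, 508),
    (303, 307, 503, 606), (409, 407, 609, 706), (4, 5, 307, 404), (4, 6, 408, 504),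
    (5, 0, 308, 405), (5, 1, 510, 905), (5, 3, 510, 605), (10, 8, 410, 505), (102, 2, 105, 506),
    (103, 105, 203, 406), (104, 106, 504, 508), (104, 108, 205, 504), (203, 1, 205, 803),
    (203, 205, 503, 506), (203, 205, 607, 803), (203, 207, 304, 503), (204, 206, 507, 604),
    (211, 207, 411, 706), (0, 1, 100, 606), (0, 6, 100, 505), (1, 0, 506, 901), (1, 6, 201, 405),
    (1, 7, 102, 601), (1, 8, 102, 301), (2, 1, 305, 402), (2, 6, 103, 402), (2, 7, 103, 202),
    (3, 1, 205, 603), (3, 1, 407, 603), (3, 2, 203, 306), (3, 2, 306, 403), (3, 5, 203, 306),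
    (4, 0, 105, 304), (4, 2, 307, 804), (4, 2, 408, 604), (9, 12, 209, 405), (10, 12, 310, 406),
    (11, 9, 211, 506), (11, 12, 411, 803), (11, 13, 611, 803), (12, 1, 212, 804),
    (12, 11, 212, 705), (13, 6, 213, 706), (101, 0, 105, 401), (101, 103, 201, 606),
    (102, 1, 105, 502), (102, 105, 203, 502), (103, 101, 204, 703), (103, 104, 303, 406),
    (103, 105, 303, 406), (104, 100, 205, 704), (104, 101, 205, 504), (111, 11, 113, 705),
    (112, 111, 212, 706), (203, 205, 403, 506), (211, 209, 411, 805), (303, 305, 503, 606)]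
    = true := by
  decide +kernel

theorem isWinning_15 : isWinning 15 607 708 806
    [(105, 307, 608, 705), (305, 307, 608, 705), (6, 105, 107, 606), (409, 309, 411, 706),
    (5, 6, 409, 605), (5, 4, 510, 605), (304, 306, 504, 607), (7, 106, 108, 407),
    (203, 204, 403, 506), (204, 206, 604, 608), (204, 206, 608, 804), (205, 7, 508, 705),
    (410, 408, 610, 806), (509, 507, 709, 806), (4, 6, 408, 504), (5, 2, 510, 605),
    (106, 5, 7, 406), (107, 206, 208, 807), (108, 7, 8, 405), (109, 208, 509, 606),
    (110, 108, 310, 605), (206, 105, 107, 506), (207, 106, 108, 507), (303, 307, 606, 703),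
    (1, 2, 203, 1301), (2, 1, 305, 602), (3, 8, 104, 603), (4, 6, 408, 604), (5, 1, 106, 505),
    (5, 1, 106, 1005), (102, 100, 405, 1402), (103, 2, 105, 403), (103, 102, 503, 507),
    (104, 106, 504, 508), (110, 108, 310, 506), (110, 109, 310, 506), (111, 107, 311, 705),
    (202, 2, 207, 606), (202, 102, 208, 404), (203, 102, 205, 503), (204, 4, 200, 507),
    (204, 206, 507, 604), (0, 8, 100, 707), (1, 0, 304, 901), (1, 0, 607, 701), (1, 6, 101, 607),
    (1, 13, 201, 607), (1, 14, 101, 102), (2, 0, 305, 902), (2, 0, 507, 702), (2, 6, 103, 402),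
    (3, 1, 306, 803), (3, 2, 306, 403), (3, 13, 203, 306), (4, 2, 307, 404), (4, 2, 408, 604),
    (4, 3, 307, 404), (10, 13, 210, 406), (12, 13, 412, 606), (101, 0, 107, 401),
    (101, 1, 107, 202), (101, 103, 201, 606), (101, 103, 301, 606), (102, 1, 105, 502),
    (102, 1, 109, 502), (102, 2, 100, 405), (102, 103, 203, 502), (102, 103, 302, 405),
    (102, 103, 302, 607), (102, 106, 203, 502), (102, 107, 203, 302), (103, 2, 100, 303),
    (103, 100, 204, 503), (103, 104, 303, 406), (104, 100, 205, 704), (104, 101, 205, 504),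
    (202, 206, 303, 602), (203, 205, 403, 506), (212, 12, 214, 806), (303, 103, 301, 606)]
    = true := by
  decide +kernel

theorem isWinning_16 : isWinning 16 607 709 906
    [(508, 506, 805, 908), (307, 309, 408, 807), (606, 507, 609, 806), (310, 308, 510, 805),
    (407, 508, 605, 707), (410, 310, 412, 806), (410, 412, 710, 806), (510, 506, 710, 807),
    (205, 203, 609, 805), (206, 202, 307, 806), (207, 205, 611, 807), (304, 306, 404, 607),
    (305, 306, 608, 705), (404, 406, 504, 606), (406, 404, 507, 706), (408, 409, 606, 1008),
    (6, 4, 410, 606), (106, 104, 207, 906), (107, 6, 8, 807), (107, 206, 208, 707),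
    (107, 207, 305, 309), (204, 200, 406, 804), (205, 407, 506, 705), (206, 305, 509, 606),
    (207, 306, 409, 507), (210, 214, 510, 606), (303, 103, 309, 606), (306, 3, 309, 506),
    (307, 303, 408, 607), (311, 309, 511, 707), (6, 0, 511, 806), (6, 105, 309, 906),
    (7, 205, 209, 607), (7, 207, 209, 502), (104, 107, 205, 504), (105, 4, 100, 505),
    (105, 4, 101, 1105), (105, 106, 509, 705), (106, 205, 308, 406), (106, 207, 406, 601),
    (107, 206, 309, 407), (108, 7, 308, 504), (110, 106, 210, 605), (204, 205, 608, 804),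
    (207, 306, 308, 507), (6, 106, 309, 602), (6, 107, 306, 501), (7, 106, 108, 507),
    (7, 106, 108, 707), (8, 108, 109, 206), (104, 114, 205, 404), (105, 106, 509, 605),
    (107, 6, 8, 407), (107, 206, 208, 407), (109, 8, 409, 505), (111, 109, 311, 705),
    (204, 4, 200, 507), (204, 206, 305, 604), (211, 209, 411, 607), (213, 209, 513, 906),
    (304, 1, 306, 504), (304, 306, 504, 607), (404, 406, 604, 707), (5, 3, 308, 805),
    (5, 7, 106, 505), (5, 7, 106, 1005), (5, 8, 409, 505), (5, 12, 207, 805), (7, 106, 108, 307),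
    (7, 106, 108, 607), (10, 13, 410, 505), (103, 108, 204, 603), (103, 109, 403, 406),
    (103, 109, 406, 503), (104, 106, 205, 504), (104, 106, 609, 904), (110, 109, 510, 605),
    (204, 206, 608, 804), (212, 213, 412, 707), (303, 307, 503, 606), (303, 307, 606, 703),
    (2, 5, 204, 1002), (2, 6, 102, 507), (2, 8, 406, 602), (3, 9, 103, 306), (4, 6, 408, 1104),
    (4, 6, 509, 604), (4, 7, 105, 304), (4, 7, 307, 504), (5, 0, 308, 405), (5, 2, 207, 505),
    (5, 3, 510, 605), (10, 11, 210, 505), (10, 13, 210, 505), (12, 8, 112, 507), (13, 2, 613, 904),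
    (102, 105, 203, 702), (102, 107, 405, 602), (103, 101, 406, 1003), (104, 3, 105, 504),
    (104, 3, 109, 504), (104, 106, 508, 704), (111, 109, 311, 507), (114, 14, 109, 807),
    (202, 2, 207, 606), (203, 3, 200, 405), (203, 3, 209, 506), (203, 102, 205, 803),
    (203, 205, 503, 607), (203, 207, 304, 503), (204, 206, 507, 604), (213, 210, 413, 906),
    (0, 8, 200, 202), (0, 9, 100, 606), (0, 9, 505, 600), (1, 0, 304, 1001), (1, 0, 506, 601),
    (1, 0, 708, 1501), (1, 3, 201, 506), (1, 4, 102, 901), (1, 8, 102, 701), (1, 9, 101, 607),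
    (1, 9, 102, 801), (1, 11, 102, 601), (2, 0, 204, 402), (2, 0, 305, 902), (2, 0, 608, 702),
    (2, 3, 102, 204), (2, 8, 202, 406), (2, 9, 103, 402), (2, 13, 103, 402), (3, 1, 104, 603),
    (3, 1, 306, 903), (3, 2, 205, 603), (3, 2, 306, 403), (3, 8, 203, 306), (4, 0, 105, 304),
    (4, 0, 105, 604), (4, 2, 408, 604), (4, 3, 307, 404), (12, 14, 612, 705), (13, 14, 413, 805),
    (14, 3, 114, 905), (14, 6, 214, 905), (14, 7, 214, 707), (15, 0, 115, 807), (15, 5, 615, 807),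
    (15, 13, 215, 906), (101, 0, 107, 501), (101, 0, 110, 401), (101, 0, 111, 701),
    (101, 103, 301, 606), (101, 108, 202, 801), (101, 109, 202, 301), (101, 109, 202, 401),
    (102, 1, 105, 502), (102, 1, 108, 502), (102, 1, 109, 502), (102, 2, 100, 506),
    (102, 104, 302, 607), (102, 106, 203, 302), (102, 109, 203, 502), (103, 2, 100, 303),
    (103, 2, 101, 403), (103, 3, 101, 406), (103, 104, 303, 406), (103, 105, 303, 406),
    (104, 3, 101, 504), (104, 100, 205, 704), (113, 111, 313, 806), (113, 112, 313, 905),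
    (202, 0, 204, 302), (202, 0, 204, 402), (202, 204, 302, 404), (202, 206, 303, 602),
    (203, 3, 201, 506), (203, 205, 403, 506), (303, 305, 503, 606)] = true := by
  decide +kernel

theorem isWinning_17 : isWinning 17 707 809 907
    [(406, 409, 507, 706), (506, 209, 606, 708), (508, 607, 609, 708), (406, 204, 402, 606),
    (505, 507, 605, 808), (307, 303, 408, 607), (206, 202, 307, 706), (206, 202, 307, 806),
    (208, 307, 309, 908), (8, 109, 206, 808), (205, 201, 306, 505), (211, 209, 611, 706),
    (308, 207, 209, 608), (405, 409, 605, 708), (408, 507, 509, 708), (7, 106, 108, 307),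
    (10, 309, 310, 604), (105, 107, 509, 705), (205, 202, 405, 407), (304, 305, 504, 708),
    (306, 309, 407, 706), (312, 311, 512, 807), (5, 7, 409, 605), (6, 107, 406, 900),
    (106, 7, 409, 606), (106, 7, 510, 606), (106, 206, 304, 308), (107, 206, 410, 707),
    (205, 201, 306, 805), (205, 204, 407, 505), (210, 208, 610, 705), (305, 307, 709, 905),
    (306, 303, 407, 706), (404, 408, 707, 804), (405, 407, 605, 708), (5, 0, 207, 305),
    (7, 108, 205, 507), (7, 209, 407, 502), (107, 206, 309, 407), (107, 207, 404, 410),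
    (108, 209, 306, 708), (110, 9, 410, 506), (205, 202, 306, 605), (213, 209, 413, 807),
    (305, 2, 307, 705), (305, 307, 608, 705), (6, 0, 107, 506), (7, 207, 209, 304),
    (8, 107, 109, 608), (9, 110, 306, 1009), (10, 6, 410, 505), (10, 110, 208, 601),
    (10, 110, 208, 607), (103, 3, 110, 406), (105, 206, 208, 605), (106, 7, 308, 406),
    (106, 205, 409, 506), (108, 207, 209, 608), (111, 110, 211, 606), (112, 109, 412, 706),
    (202, 208, 802, 808), (204, 200, 507, 804), (204, 202, 608, 1204), (404, 406, 604, 707),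
    (5, 2, 207, 505), (6, 0, 511, 806), (6, 4, 410, 606), (6, 208, 306, 607), (7, 106, 209, 307),
    (8, 107, 109, 208), (8, 107, 109, 508), (11, 9, 411, 704), (103, 102, 406, 803),
    (105, 4, 113, 605), (105, 100, 206, 405), (105, 106, 206, 605), (105, 106, 610, 705),
    (105, 107, 610, 905), (107, 206, 208, 407), (108, 207, 209, 408), (111, 110, 311, 606),
    (204, 104, 200, 406), (204, 206, 404, 608), (303, 202, 306, 603), (4, 9, 307, 504),
    (5, 7, 106, 505), (5, 7, 106, 1005), (5, 7, 505, 510), (8, 107, 109, 308), (11, 9, 211, 506),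
    (103, 106, 203, 406), (104, 103, 407, 504), (104, 105, 407, 504), (104, 106, 204, 508),
    (104, 109, 306, 704), (105, 4, 100, 505), (105, 4, 101, 605), (111, 110, 511, 606),
    (113, 109, 313, 707), (204, 206, 608, 804), (213, 113, 215, 906), (1, 9, 607, 901),
    (2, 9, 103, 1002), (2, 10, 103, 502), (2, 10, 305, 602), (3, 7, 103, 508), (3, 10, 104, 903),
    (3, 14, 203, 407), (4, 0, 304, 307), (4, 7, 104, 307), (4, 15, 105, 604), (4, 16, 105, 404),
    (5, 0, 106, 205), (5, 1, 308, 1005), (5, 3, 308, 505), (5, 3, 510, 605), (13, 14, 813, 904),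
    (102, 2, 110, 405), (102, 101, 203, 1202), (102, 108, 202, 607), (103, 108, 204, 303),
    (104, 102, 205, 904), (104, 106, 304, 508), (104, 106, 407, 504), (203, 102, 205, 803),
    (203, 102, 207, 503), (203, 205, 304, 503), (203, 207, 304, 503), (204, 4, 200, 507),
    (204, 206, 507, 604), (0, 7, 300, 707), (0, 9, 202, 500), (0, 10, 600, 808), (0, 10, 606, 900),
    (1, 0, 304, 601), (1, 0, 1001, 1011), (1, 3, 102, 801), (1, 4, 102, 601), (1, 7, 201, 607),
    (1, 8, 101, 203), (1, 9, 101, 708), (1, 9, 102, 801), (1, 9, 201, 506), (1, 10, 102, 901),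
    (1, 10, 102, 1601), (1, 11, 102, 701), (2, 0, 103, 202), (2, 7, 102, 204), (2, 7, 202, 608),
    (2, 9, 202, 507), (2, 16, 103, 402), (3, 0, 103, 205), (3, 0, 203, 407), (3, 1, 203, 306),
    (3, 7, 203, 306), (3, 9, 203, 306), (4, 0, 104, 307), (4, 0, 204, 307), (4, 2, 307, 404),
    (4, 2, 307, 804), (13, 16, 213, 607), (16, 6, 916, 1006), (101, 0, 106, 601),
    (101, 0, 110, 401), (101, 103, 201, 202), (101, 109, 202, 401), (101, 110, 202, 301),
    (101, 110, 202, 601), (102, 1, 106, 502), (102, 103, 302, 607), (102, 107, 203, 502),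
    (102, 109, 203, 302), (102, 110, 203, 302), (103, 100, 204, 503), (103, 101, 204, 403),
    (103, 104, 303, 406), (104, 100, 205, 404), (104, 100, 205, 704), (114, 14, 116, 906),
    (202, 0, 102, 200), (202, 0, 204, 302), (202, 102, 201, 404), (203, 3, 201, 506),
    (303, 0, 305, 503), (303, 103, 301, 606), (303, 305, 503, 606)] = true := by
  decide +kernel

theorem isWinning_18 : isWinning 18 708 810 907
    [(508, 507, 811, 908), (408, 509, 710, 808), (308, 407, 409, 1008), (406, 408, 709, 806),
    (506, 507, 809, 906), (206, 200, 610, 706), (208, 201, 410, 808), (306, 210, 407, 706),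
    (308, 207, 209, 708), (310, 309, 710, 805), (406, 405, 507, 806), (410, 208, 510, 707),
    (410, 309, 710, 806), (505, 509, 705, 808), (709, 707, 909, 1006), (206, 203, 509, 806),
    (305, 302, 608, 905), (305, 307, 507, 905), (307, 304, 408, 707), (311, 309, 711, 806),
    (312, 310, 612, 708), (404, 204, 408, 707), (405, 407, 505, 708), (411, 409, 611, 807),
    (412, 410, 612, 808), (511, 509, 711, 808), (611, 609, 811, 908), (106, 102, 510, 706),
    (106, 510, 604, 706), (205, 207, 609, 805), (207, 108, 510, 907), (207, 203, 510, 1207),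
    (207, 407, 510, 708), (208, 309, 603, 808), (304, 300, 404, 506), (304, 302, 405, 804),
    (304, 302, 607, 804), (304, 305, 404, 607), (304, 307, 405, 604), (305, 301, 406, 605),
    (305, 303, 406, 905), (305, 307, 505, 608), (306, 205, 308, 706), (307, 302, 408, 1107),
    (307, 303, 408, 807), (313, 315, 613, 808), (404, 406, 504, 707), (405, 304, 407, 705),
    (405, 409, 605, 708), (413, 411, 513, 908), (7, 108, 403, 507), (8, 109, 305, 608),
    (111, 116, 311, 408), (205, 104, 201, 805), (205, 201, 306, 505), (205, 204, 508, 605),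
    (206, 203, 307, 606), (206, 204, 610, 806), (211, 214, 411, 607), (211, 217, 311, 607),
    (212, 209, 412, 608), (212, 210, 412, 608), (304, 203, 300, 604), (304, 203, 309, 704),
    (304, 306, 504, 607), (305, 302, 406, 705), (306, 300, 407, 706), (306, 302, 407, 906),
    (406, 103, 408, 806), (7, 106, 108, 807), (7, 106, 209, 507), (7, 106, 209, 607),
    (7, 106, 310, 407), (7, 107, 205, 209), (7, 108, 304, 707), (7, 205, 310, 407),
    (7, 304, 310, 907), (8, 107, 311, 408), (8, 109, 206, 308), (8, 206, 210, 408),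
    (8, 210, 305, 308), (205, 201, 306, 805), (206, 105, 202, 806), (505, 202, 507, 705),
    (7, 106, 209, 307), (7, 106, 307, 310), (8, 107, 210, 308), (8, 107, 210, 508),
    (8, 107, 210, 808), (8, 107, 210, 908), (9, 110, 207, 1009), (10, 111, 210, 307),
    (109, 209, 311, 406), (8, 107, 109, 508), (8, 108, 109, 206), (105, 107, 305, 408),
    (108, 9, 310, 808), (110, 211, 310, 506), (204, 207, 304, 608), (6, 4, 309, 1006),
    (6, 5, 406, 410), (6, 8, 107, 1006), (6, 9, 107, 406), (6, 10, 107, 1006), (6, 12, 107, 606),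
    (11, 13, 311, 407), (105, 100, 206, 405), (107, 8, 410, 507), (107, 305, 309, 607),
    (108, 207, 209, 508), (108, 207, 209, 908), (108, 207, 411, 908), (109, 210, 309, 406),
    (110, 210, 312, 506), (204, 200, 504, 608), (204, 202, 608, 804), (303, 307, 404, 703),
    (314, 114, 313, 908), (6, 0, 107, 406), (6, 0, 406, 410), (6, 4, 410, 606), (11, 16, 211, 407),
    (11, 17, 211, 407), (104, 103, 609, 904), (105, 4, 103, 1105), (105, 107, 408, 605),
    (105, 107, 408, 905), (106, 7, 510, 606), (106, 205, 308, 606), (106, 205, 510, 606),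
    (106, 304, 308, 606), (107, 206, 307, 309), (107, 206, 309, 707), (107, 207, 305, 309),
    (108, 306, 310, 408), (110, 210, 211, 506), (111, 10, 211, 606), (204, 4, 200, 305),
    (204, 202, 507, 1004), (303, 0, 305, 403), (404, 4, 303, 400), (6, 4, 107, 606),
    (6, 8, 612, 1006), (104, 106, 304, 306), (104, 108, 407, 904), (105, 4, 100, 505),
    (105, 4, 101, 305), (105, 4, 101, 605), (105, 109, 610, 705), (107, 206, 309, 407),
    (107, 206, 410, 507), (108, 207, 310, 408), (204, 203, 406, 504), (214, 210, 814, 1006),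
    (303, 311, 403, 606), (314, 310, 714, 908), (4, 10, 307, 1004), (5, 3, 106, 1005),
    (5, 8, 207, 305), (11, 7, 411, 605), (11, 12, 411, 605), (11, 17, 411, 506),
    (103, 2, 110, 403), (104, 3, 111, 504), (105, 106, 206, 605), (105, 106, 509, 605),
    (105, 107, 610, 905), (108, 207, 209, 408), (112, 111, 212, 607), (112, 111, 312, 607),
    (204, 4, 200, 507), (204, 202, 406, 604), (204, 206, 404, 608), (3, 10, 103, 508),
    (5, 0, 207, 305), (5, 9, 510, 705), (5, 10, 105, 308), (5, 11, 106, 505), (13, 16, 213, 805),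
    (103, 110, 204, 303), (103, 110, 204, 503), (103, 111, 204, 603), (104, 102, 604, 609),
    (104, 109, 205, 404), (104, 110, 205, 704), (104, 111, 205, 304), (112, 111, 512, 607),
    (113, 109, 513, 707), (114, 109, 314, 807), (203, 204, 708, 803), (204, 206, 608, 804),
    (303, 306, 505, 603), (303, 307, 503, 606), (1, 3, 809, 1501), (1, 5, 607, 801),
    (1, 13, 203, 501), (2, 3, 302, 406), (2, 7, 102, 507), (2, 7, 204, 1002), (2, 9, 103, 602),
    (2, 10, 102, 305), (3, 1, 811, 1003), (3, 2, 407, 1003), (3, 9, 104, 803), (3, 12, 303, 407),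
    (4, 0, 604, 610), (4, 1, 509, 604), (4, 2, 307, 1004), (4, 3, 404, 408), (4, 9, 104, 307),
    (4, 9, 204, 408), (4, 10, 104, 408), (4, 17, 105, 404), (5, 1, 106, 505), (5, 1, 308, 505),
    (5, 1, 510, 705), (5, 3, 510, 605), (12, 6, 212, 507), (12, 10, 212, 507), (12, 16, 212, 507),
    (13, 17, 613, 805), (14, 1, 214, 806), (14, 10, 114, 608), (101, 106, 301, 606),
    (102, 2, 108, 708), (102, 105, 304, 902), (102, 107, 302, 607), (102, 109, 202, 203),
    (102, 109, 203, 402), (103, 2, 111, 503), (103, 102, 204, 703), (103, 102, 403, 608),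
    (103, 106, 303, 507), (103, 108, 403, 507), (104, 3, 100, 504), (104, 105, 304, 508),
    (104, 106, 205, 504), (104, 106, 407, 504), (104, 107, 205, 504), (116, 111, 316, 1106),
    (203, 1, 202, 503), (203, 1, 205, 803), (203, 102, 207, 503), (203, 200, 405, 603),
    (203, 204, 405, 503), (203, 205, 405, 503), (203, 207, 403, 506), (204, 206, 507, 604),
    (215, 209, 415, 1007), (215, 214, 315, 1007), (0, 7, 700, 707), (0, 8, 100, 808),
    (0, 8, 200, 808), (0, 9, 900, 909), (0, 10, 1000, 1010), (1, 0, 102, 901), (1, 0, 506, 701),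
    (1, 0, 701, 708), (1, 3, 102, 1101), (1, 4, 102, 1101), (1, 4, 102, 1301), (1, 5, 102, 601),
    (1, 7, 101, 506), (1, 8, 201, 708), (1, 9, 101, 607), (1, 9, 102, 801), (1, 10, 102, 901),
    (1, 10, 201, 607), (1, 11, 102, 1001), (2, 0, 204, 302), (2, 1, 402, 507), (2, 3, 103, 202),
    (2, 3, 103, 402), (2, 7, 202, 305), (2, 8, 103, 202), (2, 10, 103, 402), (2, 10, 202, 507),
    (2, 14, 103, 402), (3, 0, 203, 508), (3, 2, 205, 303), (3, 7, 203, 306), (3, 8, 203, 306),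
    (3, 9, 203, 306), (3, 10, 203, 306), (3, 11, 203, 306), (4, 0, 104, 307), (4, 0, 105, 604),
    (4, 2, 304, 408), (4, 2, 307, 804), (4, 2, 408, 604), (14, 16, 614, 707), (15, 8, 215, 708),
    (15, 16, 415, 1005), (16, 7, 116, 907), (16, 8, 216, 808), (101, 0, 107, 601),
    (101, 0, 109, 201), (101, 0, 110, 501), (101, 1, 100, 808), (101, 106, 202, 301),
    (101, 107, 202, 501), (101, 108, 202, 401), (101, 110, 202, 901), (101, 116, 202, 601),
    (102, 1, 100, 1002), (102, 1, 100, 1102), (102, 1, 106, 502), (102, 1, 110, 502),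
    (102, 103, 302, 607), (102, 104, 302, 708), (102, 106, 203, 302), (102, 106, 203, 502),
    (102, 107, 203, 302), (102, 108, 203, 302), (102, 110, 203, 502), (102, 111, 203, 502),
    (102, 116, 203, 302), (103, 100, 204, 503), (103, 101, 204, 703), (103, 105, 303, 406),
    (104, 100, 205, 704), (104, 101, 205, 504), (115, 113, 315, 1105), (116, 114, 216, 908),
    (202, 0, 204, 302), (202, 204, 402, 808), (203, 3, 201, 506), (203, 205, 403, 506),
    (215, 15, 217, 908), (303, 305, 503, 606)] = true := by
  decide +kernel

theorem isCopWin_queenGraph {n : ℕ} (h7 : 7 ≤ n) (h18 : n ≤ 18) : IsCopWin (queenGraph n) 3 := by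
  interval_cases n
  · exact isCopWin_of_isWinning (by norm_num) isWinning_7
  · exact isCopWin_of_isWinning (by norm_num) isWinning_8
  · exact isCopWin_of_isWinning (by norm_num) isWinning_9
  · exact isCopWin_of_isWinning (by norm_num) isWinning_10
  · exact isCopWin_of_isWinning (by norm_num) isWinning_11
  · exact isCopWin_of_isWinning (by norm_num) isWinning_12
  · exact isCopWin_of_isWinning (by norm_num) isWinning_13
  · exact isCopWin_of_isWinning (by norm_num) isWinning_14
  · exact isCopWin_of_isWinning (by norm_num) isWinning_15
  · exact isCopWin_of_isWinning (by norm_num) isWinning_16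
  · exact isCopWin_of_isWinning (by norm_num) isWinning_17
  · exact isCopWin_of_isWinning (by norm_num) isWinning_18

end CopsAndRobbers

theorem theorem1p3 (n : ℕ) (h7 : 7 ≤ n) (h18 : n ≤ 18) :
    CopsAndRobbers.copNumber (CopsAndRobbers.queenGraph n) = 3 := by
  have hwin := CopsAndRobbers.isCopWin_queenGraph h7 h18
  -- Nonemptiness matters for the lower bound, since `sInf ∅ = 0` in ℕ.
  refine le_antisymm (Nat.sInf_le hwin) (le_csInf ⟨3, hwin⟩ fun k hk => ?_)
  by_contra! h
  exact CopsAndRobbers.not_isCopWin_queenGraph h7 h hk
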